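/- Let $L\subseteq\{0,1\}^*$ be a language, and write $L(x)=1$ if $x\in L$ and $L(x)=0$ otherwise. For every $n$ let $\mathcal D_n$ be a probability distribution on $\{0,1\}^n$. Let $k=k(n)\ge 1$ with $k=O(\lg n)$, let $\ell=\ell(n)$, and let $\Sigma_n=\bigcup_{i=0}^{\ell}\{0,1\}^i$ with $|\Sigma_n|=n^{O(1)}$. Let $\delta=\delta(n)$ be such that $\delta<1/2$ for every $n$ and, for some constant $c$, $\delta(n)>1/n^{c}$ for all large $n$. Let $(C_n)$ be Boolean circuits of polynomial size, where $C_n$ takes as input $k$ instances in $\{0,1\}^n$ and a help string in $\Sigma_n$, and outputs $k$ bits. Let $X_1,\dots,X_k$ be drawn independently from $\mathcal D_n$. Entropy and mutual information are measured in bits. (i) Suppose that for every $n$ and all $x_1,\dots,x_k\in\{0,1\}^n$ there is a help string $s(x_1,\dots,x_k)\in\Sigma_n$ (a fixed function of the instances) with $$C_n(x_1,\dots,x_k,s(x_1,\dots,x_k))=(L(x_1),\dots,L(x_k)),$$ and that $S=s(X_1,\dots,X_k)$ satisfies $H(S)\le k-3k\delta$ for every $n$. Then there are polynomial-size circuits $(B_n)$,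 which receive no help, such that for every $n$ $$\Pr_{X\sim\mathcal D_n}[B_n(X)=L(X)]\ \ge\ \tfrac12+\delta .$$ (ii) The same conclusion holds if the entropy bound is replaced by $I(X_1,\dots,X_k;S)\le k-3k\delta$. Here the help may also be random given the instances, as long as, for all $x_1,\dots,x_k$, every help string $s$ that has positive conditional probability given $x_1,\dots,x_k$ satisfies $C_n(x_1,\dots,x_k,s)=(L(x_1),\dots,L(x_k))$. -/

import Mathlib

namespace HelpBits

/-! ### Languages, instances, help strings -/

/-- Instances of size `n`: the set `{0,1}^n`. -/
abbrev Bits (n : ℕ) : Type := Fin n → Bool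

open Classical in
/-- The indicator `L(x)` of a language: `true` if the string `x` is in `L`, else `false`. -/
noncomputable def answer (L : Language Bool) {n : ℕ} (x : Bits n) : Bool :=
  decide (List.ofFn x ∈ L)

/-- The alphabet of help strings: all bit strings of length at most `ℓ`. -/
abbrev HelpString (ℓ : ℕ) : Type := (i : Fin (ℓ + 1)) × (Fin (i : ℕ) → Bool)

/-- The self-delimiting encoding `s ↦ s 1 0 ⋯ 0` of a help string of length at most `ℓ` on exactly
`ℓ + 1` input wires, so that it can be fed to a circuit. -/
def HelpString.encode {ℓ : ℕ} (s : HelpString ℓ) : Bits (ℓ + 1) := fun j =>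
  if h : (j : ℕ) < (s.1 : ℕ) then s.2 ⟨j, h⟩ else decide ((j : ℕ) = (s.1 : ℕ))

/-! ### Boolean circuits -/

/-- A gate over the wires `W`: a constant, a negation, or a conjunction or disjunction of
fan-in two. -/
inductive Gate (W : Type) : Type
  | const (b : Bool) : Gate W
  | not (a : W) : Gate W
  | and (a b : W) : Gate W
  | or (a b : W) : Gate W

/-- The bit computed by a gate when the wires carry the values `v`. -/
def Gate.eval {W : Type} : Gate W → (W → Bool) → Bool
  | .const b, _ => b
  | .not a, v => !(v a)
  | .and a b, v => v a && v b
  | .or a b, v => v a || v b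

/-- Boolean circuits with outputs labelled by `O` and input wires labelled by `W`, listed in
topological order. `out o` has no gate; its output `y` is the wire `o y`. `gate g c` computes the
gate `g` from the wires `W` and then runs `c`, whose wires are those in `W` together with one new
wire (`none`) that carries the value of `g`. A wire can be used any number of times. -/
inductive Circuit (O : Type) : Type → Type 1
  | out {W : Type} (o : O → W) : Circuit O W
  | gate {W : Type} (g : Gate W) (c : Circuit O (Option W)) : Circuit O W

/-- The output of a circuit on a given input. -/
def Circuit.eval {O : Type} : {W : Type} → Circuit O W → (W → Bool) → O → Bool
  | _, .out o, v => fun y => v (o y)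
  | _, .gate g c, v => c.eval (fun w => w.elim (g.eval v) v)

/-- The size of a circuit: its number of gates. -/
def Circuit.size {O : Type} : {W : Type} → Circuit O W → ℕ
  | _, .out _ => 0
  | _, .gate _ c => c.size + 1

/-- `f(n) = n^{O(1)}`. -/
def PolyBounded (f : ℕ → ℕ) : Prop := ∃ c : ℕ, ∀ n : ℕ, f n ≤ n ^ c + c

/-- Circuits that take `k` instances of size `n` and a help string of length at most `ℓ`, and
output `k` bits. -/
abbrev SolverCircuit (n k ℓ : ℕ) : Type 1 :=
  Circuit (Fin k) ((Fin k × Fin n) ⊕ Fin (ℓ + 1))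

/-- The output of a solver on the instances `x` with the help string `s`. -/
def SolverCircuit.run {n k ℓ : ℕ} (C : SolverCircuit n k ℓ) (x : Fin k → Bits n)
    (s : HelpString ℓ) : Fin k → Bool :=
  Circuit.eval C (Sum.elim (fun p => x p.1 p.2) s.encode)

/-! ### Probability and information -/

/-- The joint law of `k` independent samples from `D`. -/
noncomputable def iid {α : Type} [Fintype α] (D : PMF α) (k : ℕ) : PMF (Fin k → α) :=
  PMF.ofFintype (fun x => ∏ i, D (x i)) (by
    classical
    have h := Finset.prod_univ_sum (fun _ : Fin k => (Finset.univ : Finset α))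
      (fun _ a => D a)
    rw [Fintype.piFinset_univ] at h
    rw [← h]
    have h1 : ∑ a, D a = 1 := by
      rw [← tsum_fintype (L := SummationFilter.unconditional α)]
      exact D.tsum_coe
    simp [h1])

/-- Shannon entropy, in bits, of a random variable with law `p` on a finite set. -/
noncomputable def entropy {α : Type} [Fintype α] (p : PMF α) : ℝ :=
  ∑ a, (p a).toReal * Real.logb 2 (1 / (p a).toReal)

/-- Mutual information `I(X;Y) = H(X) + H(Y) - H(X,Y)`, in bits, of a pair of random variables
with joint law `p`. -/
noncomputable def mutualInfo {α β : Type} [Fintype α] [Fintype β] (p : PMF (α × β)) : ℝ :=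
  entropy (p.map Prod.fst) + entropy (p.map Prod.snd) - entropy p

/-- The joint law of `((X₁, …, X_k), S)`, where the `X_i` are independent with law `D` and, given
that they equal `x`, the help `S` has law `κ x`. If the help is a function `s` of the instances,
then `κ x = PMF.pure (s x)`. -/
noncomputable def jointLaw {n k ℓ : ℕ} (D : PMF (Bits n))
    (κ : (Fin k → Bits n) → PMF (HelpString ℓ)) : PMF ((Fin k → Bits n) × HelpString ℓ) :=
  (iid D k).bind fun x => (κ x).map (Prod.mk x)

/-- There are circuits `B_n` of polynomial size with `Pr[B_n(X) = L(X)] ≥ q(n)` for every `n`, where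
`X` has law `D_n`. -/
def SolvableOnAverage (L : Language Bool) (D : ∀ n, PMF (Bits n)) (q : ℕ → ℝ) : Prop :=
  ∃ B : ∀ n, Circuit Unit (Fin n),
    PolyBounded (fun n => (B n).size) ∧
    ∀ n, q n ≤ ((D n).toOuterMeasure {x | (B n).eval x () = answer L x}).toReal

end HelpBits

/-! Replace the real help by an independent sample from its marginal law `w`. For instances `x` let
`A i` be the `w`-probability that such a sample makes the solver correct on the first `i` of them
(`prefixWeight`). Valid help lies in the event behind `A k`, so the Gibbs inequality bounds the
expectation of `-log (A k)` by the mutual information (`sum_neg_log_le_mutualInfo`). Now `A k` is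
the product of the ratios `A (i + 1) / A i`, and `r ≥ (1 + log (2 * r)) / 2` turns this product
bound into a bound on their sum (`log_le_sum_ratio`). Hence for some `i` the expected ratio is at
least `1/2 + δ`: a sample conditioned on correctness before `i` predicts the answer at `i` well
(`exists_prefixWeight_ratio`).

It remains to make this predictor a circuit. Averaging fixes all instances but the `i`-th, so the
earlier answers become hardwired constants. The conditional sample is the first consistent string in
a random `w`-weighted ordering of the help strings, and some fixed ordering does as well on average
(`exists_list_firstMatch`). Scanning that list runs the solver once per string, and there are only
polynomially many strings.

Entropy is a special case, since for deterministic help the mutual information equals `H(S)`. -/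

namespace HelpBits

/-! ### Building circuits -/

/-- Renaming the input wires of a circuit. -/
def Gate.rename {W W' : Type} (f : W → W') : Gate W → Gate W'
  | .const b => .const b
  | .not a => .not (f a)
  | .and a b => .and (f a) (f b)
  | .or a b => .or (f a) (f b)

theorem Gate.eval_rename {W W' : Type} (f : W → W') (g : Gate W) (v : W' → Bool) :
    (g.rename f).eval v = g.eval (v ∘ f) := by
  cases g <;> rfl

/-- Renaming the input wires of a circuit. -/
def Circuit.rename {O : Type} : {W W' : Type} → (W → W') → Circuit O W → Circuit O W'
  | _, _, f, .out o => .out (f ∘ o)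
  | _, _, f, .gate g c => .gate (g.rename f) (c.rename (Option.map f))

theorem Circuit.size_rename {O W : Type} (c : Circuit O W) :
    ∀ {W' : Type} (f : W → W'), (c.rename f).size = c.size := by
  induction c with
  | out o => intro W' f; rfl
  | gate g c ih => intro W' f; simp only [Circuit.rename, Circuit.size, ih]

theorem Circuit.eval_rename {O W : Type} (c : Circuit O W) :
    ∀ {W' : Type} (f : W → W') (v : W' → Bool), (c.rename f).eval v = c.eval (v ∘ f) := by
  induction c with
  | out o => intro W' f v; rfl
  | gate g c ih =>
    intro W' f v
    simp only [Circuit.rename, Circuit.eval, ih, Gate.eval_rename]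
    congr 1
    funext w
    cases w <;> rfl

/-- Run `c` and then `d`, which may use the input wires and the outputs of `c`. -/
def Circuit.append {O O' : Type} : {W : Type} → Circuit O W → Circuit O' (W ⊕ O) → Circuit O' W
  | _, .out o, d => d.rename (Sum.elim id o)
  | _, .gate g c, d => .gate g (c.append (d.rename (Sum.map some id)))

theorem Circuit.size_append {O O' W : Type} (c : Circuit O W) :
    ∀ d : Circuit O' (W ⊕ O), (c.append d).size = c.size + d.size := by
  induction c with
  | out o => intro d; simp [Circuit.append, Circuit.size, Circuit.size_rename]
  | gate g c ih =>
    intro d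
    simp only [Circuit.append, Circuit.size, ih, Circuit.size_rename]
    omega

theorem Circuit.eval_append {O O' W : Type} (c : Circuit O W) :
    ∀ (d : Circuit O' (W ⊕ O)) (v : W → Bool),
      (c.append d).eval v = d.eval (Sum.elim v (c.eval v)) := by
  induction c with
  | out o =>
    intro d v
    simp only [Circuit.append, Circuit.eval, Circuit.eval_rename]
    congr 1
    funext w
    cases w <;> rfl
  | gate g c ih =>
    intro d v
    simp only [Circuit.append, Circuit.eval, ih, Circuit.eval_rename]
    congr 1
    funext w
    cases w <;> rfl

/-- The function `f` is computed by a circuit with at most `m` gates. -/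
def HasCircuit {W O : Type} (f : (W → Bool) → O → Bool) (m : ℕ) : Prop :=
  ∃ c : Circuit O W, c.size ≤ m ∧ ∀ v, c.eval v = f v

/-- The Boolean function `f` is computed by a circuit with at most `m` gates. -/
abbrev HasBoolCircuit {W : Type} (f : (W → Bool) → Bool) (m : ℕ) : Prop :=
  HasCircuit (fun v (_ : Unit) => f v) m

theorem HasCircuit.mono {W O : Type} {f : (W → Bool) → O → Bool} {m m' : ℕ}
    (h : HasCircuit f m) (hm : m ≤ m') : HasCircuit f m' :=
  let ⟨c, hc, he⟩ := h
  ⟨c, hc.trans hm, he⟩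

theorem HasCircuit.append {W O O' : Type} {f : (W → Bool) → O → Bool}
    {g : (W ⊕ O → Bool) → O' → Bool} {m m' : ℕ}
    (hf : HasCircuit f m) (hg : HasCircuit g m') :
    HasCircuit (fun v => g (Sum.elim v (f v))) (m + m') := by
  obtain ⟨c, hc, he⟩ := hf
  obtain ⟨d, hd, he'⟩ := hg
  refine ⟨c.append d, ?_, fun v => ?_⟩
  · rw [Circuit.size_append]; omega
  · rw [Circuit.eval_append, he, he']

theorem HasCircuit.comap {W W' O : Type} {f : (W → Bool) → O → Bool} {m : ℕ}
    (hf : HasCircuit f m) (r : W → W') : HasCircuit (fun v => f (v ∘ r)) m := by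
  obtain ⟨c, hc, he⟩ := hf
  exact ⟨c.rename r, by rwa [Circuit.size_rename], fun v => by rw [Circuit.eval_rename, he]⟩

theorem HasCircuit.comp {W O O' : Type} {f : (W → Bool) → O → Bool}
    {g : (O → Bool) → O' → Bool} {m m' : ℕ}
    (hf : HasCircuit f m) (hg : HasCircuit g m') : HasCircuit (fun v => g (f v)) (m + m') :=
  hf.append (hg.comap Sum.inr)

theorem hasBoolCircuit_gate {W : Type} (g : Gate W) : HasBoolCircuit g.eval 1 :=
  ⟨.gate g (.out fun _ => none), le_rfl, fun _ => rfl⟩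

theorem hasBoolCircuit_const {W : Type} (b : Bool) : HasBoolCircuit (fun _ : W → Bool => b) 1 :=
  hasBoolCircuit_gate (.const b)

theorem hasBoolCircuit_proj {W : Type} (w : W) : HasBoolCircuit (fun v : W → Bool => v w) 0 :=
  ⟨.out fun _ => w, le_rfl, fun _ => rfl⟩

theorem HasBoolCircuit.not {W : Type} {f : (W → Bool) → Bool} {m : ℕ}
    (hf : HasBoolCircuit f m) : HasBoolCircuit (fun v => !(f v)) (m + 1) :=
  HasCircuit.comp hf (hasBoolCircuit_gate (.not ()))

theorem HasBoolCircuit.and {W : Type} {f g : (W → Bool) → Bool} {m m' : ℕ}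
    (hf : HasBoolCircuit f m) (hg : HasBoolCircuit g m') :
    HasBoolCircuit (fun v => f v && g v) (m + m' + 1) := by
  have h := HasCircuit.append hf (HasCircuit.append (HasCircuit.comap hg Sum.inl)
    (hasBoolCircuit_gate (.and (Sum.inl (Sum.inr ())) (Sum.inr ()))))
  exact HasCircuit.mono h (by omega)

theorem HasBoolCircuit.or {W : Type} {f g : (W → Bool) → Bool} {m m' : ℕ}
    (hf : HasBoolCircuit f m) (hg : HasBoolCircuit g m') :
    HasBoolCircuit (fun v => f v || g v) (m + m' + 1) := by
  have h := HasCircuit.append hf (HasCircuit.append (HasCircuit.comap hg Sum.inl)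
    (hasBoolCircuit_gate (.or (Sum.inl (Sum.inr ())) (Sum.inr ()))))
  exact HasCircuit.mono h (by omega)

theorem hasBoolCircuit_eq_const {W : Type} (w : W) (b : Bool) :
    HasBoolCircuit (fun v : W → Bool => v w == b) 1 := by
  cases b
  · simpa using (hasBoolCircuit_proj w).not
  · simpa using HasCircuit.mono (hasBoolCircuit_proj w) zero_le_one

theorem hasBoolCircuit_all {W ι : Type} {f : ι → (W → Bool) → Bool} {m : ℕ}
    (hf : ∀ i, HasBoolCircuit (f i) m) (l : List ι) :
    HasBoolCircuit (fun v => l.all fun i => f i v) (l.length * (m + 1) + 1) := by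
  induction l with
  | nil => simpa using hasBoolCircuit_const true
  | cons i l ih =>
    simp only [List.all_cons]
    refine HasCircuit.mono ((hf i).and ih) ?_
    rw [List.length_cons]
    ring_nf
    omega

theorem exists_hasBoolCircuit_any {W ι : Type} {f : ι → (W → Bool) → Bool}
    (hf : ∀ i, ∃ m, HasBoolCircuit (f i) m) (l : List ι) :
    ∃ m, HasBoolCircuit (fun v => l.any fun i => f i v) m := by
  induction l with
  | nil => exact ⟨1, by simpa using hasBoolCircuit_const false⟩
  | cons i l ih =>
    obtain ⟨m, hm⟩ := hf i
    obtain ⟨m', hm'⟩ := ih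
    exact ⟨_, by simpa only [List.any_cons] using hm.or hm'⟩

/-- Every Boolean function of finitely many wires has a circuit, its disjunctive normal form. -/
theorem exists_hasBoolCircuit {W : Type} [Fintype W] (f : (W → Bool) → Bool) :
    ∃ m, HasBoolCircuit f m := by
  classical
  have h := exists_hasBoolCircuit_any (W := W) (ι := W → Bool)
    (f := fun u v => (Finset.univ : Finset W).toList.all fun w => v w == u w)
    (fun u => ⟨_, hasBoolCircuit_all (fun w => hasBoolCircuit_eq_const w (u w)) _⟩)
    ((Finset.univ : Finset (W → Bool)).filter fun u => f u = true).toList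
  convert h using 5 with m v
  rw [Bool.eq_iff_iff]
  simp only [List.any_eq_true, Finset.mem_toList, Finset.mem_filter, Finset.mem_univ, true_and,
    List.all_eq_true, beq_iff_eq, forall_const]
  constructor
  · exact fun hv => ⟨v, hv, fun _ => rfl⟩
  · rintro ⟨u, hu, huv⟩
    rwa [show v = u from funext huv]

/-- Feeding each wire with a constant or with an input costs two gates. -/
theorem hasCircuit_substitution {W W' : Type} (σ : W → Bool ⊕ W') :
    HasCircuit (fun (v : W' → Bool) w => Sum.elim id v (σ w)) 2 := by
  refine ⟨.gate (.const true) (.gate (.const false)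
    (.out fun w => Sum.elim (fun b => if b then some none else none) (fun w' => some (some w'))
      (σ w))), le_rfl, fun v => ?_⟩
  funext w
  simp only [Circuit.eval]
  rcases σ w with (_ | _) | w' <;> rfl

/-- The value of `out` at the first element of the list that satisfies `test`. -/
def firstMatch {ι : Type} (test out : ι → Bool) : List ι → Bool
  | [] => false
  | i :: l => (test i && out i) || (!(test i) && firstMatch test out l)

/-- Test and output come from one joint circuit, so that a single run of the solver serves both. The
selection costs four further gates per list entry. -/
theorem hasBoolCircuit_firstMatch {W ι : Type} {test out : ι → (W → Bool) → Bool} {m : ℕ}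
    (h : ∀ i, HasCircuit (fun v => Sum.elim (fun _ : Unit => test i v) (fun _ : Unit => out i v)) m)
    (l : List ι) :
    HasBoolCircuit (fun v => firstMatch (test · v) (out · v) l) (l.length * (m + 4) + 1) := by
  induction l with
  | nil => simpa [firstMatch] using hasBoolCircuit_const false
  | cons i l ih =>
    have h1 : HasBoolCircuit (W := W ⊕ (Unit ⊕ Unit))
        (fun v => (v (.inr (.inl ())) && v (.inr (.inr ()))) ||
          (!(v (.inr (.inl ()))) && firstMatch (test · (v ∘ .inl)) (out · (v ∘ .inl)) l)) _ :=
      ((hasBoolCircuit_proj _).and (hasBoolCircuit_proj _)).or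
        ((hasBoolCircuit_proj _).not.and (HasCircuit.comap ih Sum.inl))
    refine HasCircuit.mono (HasCircuit.append (h i) h1) ?_
    rw [List.length_cons]
    ring_nf
    omega

/-! ### Polynomial bounds -/

/-- With base `n + 1` the powers are monotone in the exponent even at `n = 0`, which makes closure
under sums and products immediate. -/
theorem polyBounded_iff {f : ℕ → ℕ} :
    PolyBounded f ↔ ∃ a c : ℕ, ∀ n, f n ≤ a * (n + 1) ^ c := by
  constructor
  · rintro ⟨c, hc⟩
    refine ⟨c + 1, c, fun n => (hc n).trans ?_⟩
    have h1 : n ^ c ≤ (n + 1) ^ c := Nat.pow_le_pow_left (Nat.le_succ n) c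
    have h2 : 1 ≤ (n + 1) ^ c := Nat.one_le_pow _ _ (Nat.succ_pos n)
    nlinarith
  · rintro ⟨a, c, h⟩
    -- The summand `a * 2 ^ c` covers `n < 2`; for larger `n`, `n + 1 ≤ n ^ 2` and `a ≤ n ^ a` give
    -- the exponent `2 * c + a`.
    refine ⟨2 * c + a + a * 2 ^ c, fun n => (h n).trans ?_⟩
    rcases Nat.lt_or_ge n 2 with hn | hn
    · have h1 : (n + 1) ^ c ≤ 2 ^ c := Nat.pow_le_pow_left (by omega) c
      have h2 := Nat.mul_le_mul_left a h1
      omega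
    · have h1 : (n + 1) ^ c ≤ n ^ (2 * c) := by
        rw [pow_mul]
        exact Nat.pow_le_pow_left (by nlinarith) c
      have h2 : a ≤ n ^ a := (Nat.lt_pow_self (by omega)).le
      calc a * (n + 1) ^ c ≤ n ^ a * n ^ (2 * c) := Nat.mul_le_mul h2 h1
        _ = n ^ (2 * c + a) := by rw [← pow_add, add_comm]
        _ ≤ n ^ (2 * c + a + a * 2 ^ c) := Nat.pow_le_pow_right (by omega) (by omega)
        _ ≤ _ := Nat.le_add_right _ _

theorem PolyBounded.const (a : ℕ) : PolyBounded fun _ => a :=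
  polyBounded_iff.2 ⟨a, 0, fun n => by simp⟩

theorem PolyBounded.add {f g : ℕ → ℕ} (hf : PolyBounded f) (hg : PolyBounded g) :
    PolyBounded fun n => f n + g n := by
  obtain ⟨a, c, h⟩ := polyBounded_iff.1 hf
  obtain ⟨b, d, h'⟩ := polyBounded_iff.1 hg
  refine polyBounded_iff.2 ⟨a + b, c + d, fun n => ?_⟩
  have h1 : (n + 1) ^ c ≤ (n + 1) ^ (c + d) := Nat.pow_le_pow_right (Nat.succ_pos n) (by omega)
  have h2 : (n + 1) ^ d ≤ (n + 1) ^ (c + d) := Nat.pow_le_pow_right (Nat.succ_pos n) (by omega)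
  rw [add_mul]
  exact add_le_add ((h n).trans (Nat.mul_le_mul_left a h1))
    ((h' n).trans (Nat.mul_le_mul_left b h2))

theorem PolyBounded.mul {f g : ℕ → ℕ} (hf : PolyBounded f) (hg : PolyBounded g) :
    PolyBounded fun n => f n * g n := by
  obtain ⟨a, c, h⟩ := polyBounded_iff.1 hf
  obtain ⟨b, d, h'⟩ := polyBounded_iff.1 hg
  refine polyBounded_iff.2 ⟨a * b, c + d, fun n => (Nat.mul_le_mul (h n) (h' n)).trans_eq ?_⟩
  rw [pow_add]; ring

theorem PolyBounded.of_eventually_le {f g : ℕ → ℕ} (hg : PolyBounded g)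
    (h : ∀ᶠ n in Filter.atTop, f n ≤ g n) : PolyBounded f := by
  obtain ⟨N, hN⟩ := Filter.eventually_atTop.1 h
  obtain ⟨c, hc⟩ := hg.add (PolyBounded.const (∑ i ∈ Finset.range N, f i))
  refine ⟨c, fun n => le_trans ?_ (hc n)⟩
  rcases lt_or_ge n N with hn | hn
  · exact (Finset.single_le_sum (fun _ _ => Nat.zero_le _) (Finset.mem_range.2 hn)).trans
      (Nat.le_add_left _ _)
  · exact (hN n hn).trans (Nat.le_add_right _ _)

theorem polyBounded_of_isBigO_logb {k : ℕ → ℕ}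
    (hk : (fun n => (k n : ℝ)) =O[Filter.atTop] fun n => Real.logb 2 (n : ℝ)) :
    PolyBounded k := by
  obtain ⟨c, hc⟩ := hk.bound
  obtain ⟨a, ha⟩ := exists_nat_ge (|c| / Real.log 2)
  have hlog : 0 < Real.log 2 := Real.log_pos (by norm_num)
  refine PolyBounded.of_eventually_le (g := fun n => a * (n + 1))
    (polyBounded_iff.2 ⟨a, 1, fun n => by simp⟩) ?_
  filter_upwards [hc, Filter.eventually_ge_atTop 1] with n hn h1
  have h1' : (1 : ℝ) ≤ n := by exact_mod_cast h1
  have h0 : 0 ≤ Real.log n := Real.log_nonneg h1'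
  have h2 : Real.log n ≤ n + 1 := (Real.log_le_sub_one_of_pos (by linarith)).trans (by linarith)
  rw [Real.norm_of_nonneg (Nat.cast_nonneg _), Real.logb,
    Real.norm_of_nonneg (div_nonneg h0 hlog.le)] at hn
  have h3 : (k n : ℝ) ≤ a * (n + 1) := by
    calc (k n : ℝ) ≤ c * (Real.log n / Real.log 2) := hn
      _ ≤ |c| * (Real.log n / Real.log 2) := by
          gcongr
          exact le_abs_self c
      _ = |c| / Real.log 2 * Real.log n := by ring
      _ ≤ a * (n + 1) := by gcongr
  exact_mod_cast h3

/-! ### First matches in a weighted random ordering -/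

/-- Only this direction holds: if nothing matches, the default `false` may equal `b` by accident. -/
theorem firstMatch_eq_of_firstMatch_beq {ι : Type} {test out : ι → Bool} {b : Bool} :
    ∀ {l : List ι}, firstMatch test (fun i => out i == b) l = true → firstMatch test out l = b
  | [], h => by simp [firstMatch] at h
  | i :: l, h => by
    unfold firstMatch at h ⊢
    cases ht : test i
    · rw [ht] at h
      simpa using firstMatch_eq_of_firstMatch_beq (l := l) (by simpa using h)
    · rw [ht] at h
      simpa using h

/-- If `T` is ordered at random by drawing without replacement with probabilities proportional to
`w`, then the first element that satisfies `A x` has the law `w` conditioned on `A x`. Hence some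
ordering does, on average over `x`, at least as well as a sample from the conditional law. -/
theorem exists_list_firstMatch {ι X : Type} [Fintype X] (w : ι → ℝ) (A B : X → ι → Bool)
    (T : Finset ι) (hw : ∀ i ∈ T, 0 < w i) :
    ∀ (μ : X → ℝ), (∀ x, 0 ≤ μ x) → ∃ l : List ι, l.length ≤ T.card ∧
      ∑ x, μ x * ((∑ i ∈ T with (A x i && B x i) = true, w i) / ∑ i ∈ T with A x i = true, w i) ≤
        ∑ x, μ x * if firstMatch (A x) (B x) l = true then 1 else 0 := by
  classical
  induction T using Finset.strongInduction with
  | H T ih =>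
  intro μ hμ
  rcases T.eq_empty_or_nonempty with rfl | hT
  · exact ⟨[], by simp, by simp [firstMatch]⟩
  set num : X → ℝ := fun x => ∑ i ∈ T with (A x i && B x i) = true, w i with hnum
  set den : X → ℝ := fun x => ∑ i ∈ T with A x i = true, w i with hden
  -- If `den x = 0`, the quotient is `0` by convention, and `num x ≤ den x` forces `num x = 0`.
  have hnd : ∀ x, den x * (num x / den x) = num x := by
    intro x
    rcases eq_or_ne (den x) 0 with h0 | h0
    · have hle : num x ≤ den x := by
        refine Finset.sum_le_sum_of_subset_of_nonneg ?_ ?_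
        · intro i hi
          simp only [Finset.mem_filter, Bool.and_eq_true] at hi ⊢
          exact ⟨hi.1, hi.2.1⟩
        · intro i hi _
          exact (hw i (Finset.mem_filter.1 hi).1).le
      have hge : 0 ≤ num x := Finset.sum_nonneg fun i hi => (hw i (Finset.mem_filter.1 hi).1).le
      rw [h0]
      linarith
    · field_simp
  -- Choose the first element by averaging with weights `w`: a match settles `x`, and a non-match
  -- leaves the conditional success rate unchanged. The two sides have equal `w`-weighted sums over
  -- `t`.
  have hstep : ∃ t ∈ T, ∑ x, μ x * (num x / den x) ≤ ∑ x, μ x *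
      ((if (A x t && B x t) = true then 1 else 0) +
        (if A x t = true then 0 else 1) * (num x / den x)) := by
    obtain ⟨t, ht, hle⟩ := Finset.exists_le_of_sum_le hT (f := fun t => w t *
      ∑ x, μ x * (num x / den x)) (g := fun t => w t * ∑ x, μ x *
      ((if (A x t && B x t) = true then 1 else 0) +
        (if A x t = true then 0 else 1) * (num x / den x))) (by
        refine le_of_eq ?_
        simp only [Finset.mul_sum]
        rw [Finset.sum_comm, Finset.sum_comm (s := T)]
        refine Finset.sum_congr rfl fun x _ => ?_
        have e1 : num x = ∑ t ∈ T, w t * if (A x t && B x t) = true then 1 else 0 := by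
          simp only [hnum, Finset.sum_filter, mul_ite, mul_one, mul_zero]
        have e2 : ∑ t ∈ T, w t - den x = ∑ t ∈ T, w t * if A x t = true then 0 else 1 := by
          simp only [hden, Finset.sum_filter, ← Finset.sum_sub_distrib]
          refine Finset.sum_congr rfl fun t _ => ?_
          split_ifs <;> ring
        calc ∑ t ∈ T, w t * (μ x * (num x / den x))
            = μ x * (num x + (∑ t ∈ T, w t - den x) * (num x / den x)) := by
              rw [← Finset.sum_mul]
              linear_combination μ x * hnd x
          _ = _ := by
              rw [e2, e1, Finset.sum_mul, ← Finset.sum_add_distrib, Finset.mul_sum]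
              rw [← e1]
              exact Finset.sum_congr rfl fun t _ => by ring)
    exact ⟨t, ht, le_of_mul_le_mul_left hle (hw t ht)⟩
  obtain ⟨t, ht, hle⟩ := hstep
  -- Only those `x` that `t` does not match are still undecided, so the induction continues with `μ`
  -- restricted to them; this is why `μ` is arbitrary and not normalised.
  obtain ⟨l, hl, hle'⟩ := ih (T.erase t) (Finset.erase_ssubset ht)
    (fun i hi => hw i (Finset.mem_of_mem_erase hi))
    (fun x => μ x * if A x t = true then 0 else 1)
    (fun x => mul_nonneg (hμ x) (by split_ifs <;> norm_num))
  refine ⟨t :: l, ?_, hle.trans ?_⟩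
  · rw [List.length_cons, ← Finset.card_erase_add_one ht]
    omega
  · have hmul : ∀ x, μ x * ((if (A x t && B x t) = true then 1 else 0) +
        (if A x t = true then 0 else 1) * (num x / den x)) =
        μ x * (if (A x t && B x t) = true then 1 else 0) +
        (μ x * if A x t = true then 0 else 1) *
          ((∑ i ∈ T.erase t with (A x i && B x i) = true, w i) /
            ∑ i ∈ T.erase t with A x i = true, w i) := by
      intro x
      cases hA : A x t
      · simp only [Finset.filter_erase, hnum, hden]
        rw [Finset.erase_eq_of_notMem (by simp [hA]), Finset.erase_eq_of_notMem (by simp [hA])]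
        simp
      · simp
    rw [Finset.sum_congr rfl fun x _ => hmul x, Finset.sum_add_distrib]
    refine (add_le_add_right hle' _).trans_eq ?_
    rw [← Finset.sum_add_distrib]
    refine Finset.sum_congr rfl fun x _ => ?_
    rw [firstMatch]
    cases A x t <;> simp

/-! ### Entropy and mutual information -/

theorem PMF.sum_toReal {α : Type} [Fintype α] (p : PMF α) : ∑ a, (p a).toReal = 1 := by
  rw [← ENNReal.toReal_sum fun a _ => p.apply_ne_top a,
    ← tsum_fintype (L := SummationFilter.unconditional α), p.tsum_coe, ENNReal.toReal_one]

theorem PMF.toReal_map_fst {α β : Type} [Fintype α] [Fintype β] (p : PMF (α × β)) (a : α) :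
    (p.map Prod.fst a).toReal = ∑ b, (p (a, b)).toReal := by
  classical
  rw [← ENNReal.toReal_sum fun b _ => p.apply_ne_top _]
  congr 1
  rw [PMF.map_apply, tsum_fintype, Fintype.sum_prod_type]
  rw [Finset.sum_eq_single a (fun c _ hc => by simp [hc.symm]) (by simp)]
  simp

theorem PMF.toReal_map_snd {α β : Type} [Fintype α] [Fintype β] (p : PMF (α × β)) (b : β) :
    (p.map Prod.snd b).toReal = ∑ a, (p (a, b)).toReal := by
  classical
  rw [← ENNReal.toReal_sum fun b _ => p.apply_ne_top _]
  congr 1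
  rw [PMF.map_apply, tsum_fintype, Fintype.sum_prod_type_right]
  rw [Finset.sum_eq_single b (fun c _ hc => by simp [hc.symm]) (by simp)]
  simp

theorem entropy_mul_log_two {α : Type} [Fintype α] (p : PMF α) :
    entropy p * Real.log 2 = -∑ a, (p a).toReal * Real.log (p a).toReal := by
  have h2 : Real.log 2 ≠ 0 := (Real.log_pos (by norm_num)).ne'
  rw [entropy, Finset.sum_mul, ← Finset.sum_neg_distrib]
  refine Finset.sum_congr rfl fun a _ => ?_
  rw [Real.logb, one_div, Real.log_inv]
  field_simp

theorem entropy_map_of_injective {α β : Type} [Fintype α] [Fintype β] (p : PMF α) {f : α → β}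
    (hf : Function.Injective f) : entropy (p.map f) = entropy p := by
  classical
  have happ : ∀ a, p.map f (f a) = p a := by
    intro a
    rw [PMF.map_apply, tsum_fintype,
      Finset.sum_eq_single a (fun c _ hc => by simp [hf.ne hc.symm]) (by simp)]
    simp
  have hout : ∀ b, b ∉ Set.range f → p.map f b = 0 := by
    intro b hb
    rw [PMF.map_apply, tsum_fintype]
    refine Finset.sum_eq_zero fun a _ => if_neg ?_
    rintro rfl
    exact hb ⟨a, rfl⟩
  rw [entropy, entropy]
  symm
  refine Fintype.sum_of_injective f hf _ _ (fun b hb => ?_) (fun a => ?_)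
  · simp [hout b hb]
  · rw [happ]

theorem mutualInfo_mul_log_two {α β : Type} [Fintype α] [Fintype β] (p : PMF (α × β)) :
    mutualInfo p * Real.log 2 = ∑ a, ∑ b, (p (a, b)).toReal * (Real.log (p (a, b)).toReal -
      Real.log (p.map Prod.fst a).toReal - Real.log (p.map Prod.snd b).toReal) := by
  have h1 : ∑ a, (p.map Prod.fst a).toReal * Real.log (p.map Prod.fst a).toReal =
      ∑ a, ∑ b, (p (a, b)).toReal * Real.log (p.map Prod.fst a).toReal := by
    refine Finset.sum_congr rfl fun a _ => ?_
    rw [← Finset.sum_mul, ← PMF.toReal_map_fst]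
  have h2 : ∑ b, (p.map Prod.snd b).toReal * Real.log (p.map Prod.snd b).toReal =
      ∑ a, ∑ b, (p (a, b)).toReal * Real.log (p.map Prod.snd b).toReal := by
    rw [Finset.sum_comm]
    refine Finset.sum_congr rfl fun b _ => ?_
    rw [← Finset.sum_mul, ← PMF.toReal_map_snd]
  rw [mutualInfo, sub_mul, add_mul, entropy_mul_log_two, entropy_mul_log_two, entropy_mul_log_two,
    h1, h2, Fintype.sum_prod_type]
  simp only [mul_sub, Finset.sum_sub_distrib]
  ring

/-- If `Y` lies in `G X`, then an independent copy of `Y` hits `G X` with a probability whose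
expected negative logarithm is at most the mutual information. -/
theorem sum_neg_log_le_mutualInfo {α β : Type} [Fintype α] [Fintype β] (p : PMF (α × β))
    (G : α → Finset β) (hG : ∀ a b, (a, b) ∈ p.support → b ∈ G a) :
    ∑ a, (p.map Prod.fst a).toReal * -Real.log (∑ b ∈ G a, (p.map Prod.snd b).toReal) ≤
      mutualInfo p * Real.log 2 := by
  classical
  set P : α → β → ℝ := fun a b => (p (a, b)).toReal with hP
  set P1 : α → ℝ := fun a => (p.map Prod.fst a).toReal with hP1
  set P2 : β → ℝ := fun b => (p.map Prod.snd b).toReal with hP2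
  set Q : α → ℝ := fun a => ∑ b ∈ G a, P2 b with hQ
  have hP_nonneg : ∀ a b, 0 ≤ P a b := fun _ _ => ENNReal.toReal_nonneg
  have hP1_nonneg : ∀ a, 0 ≤ P1 a := fun _ => ENNReal.toReal_nonneg
  have hP2_nonneg : ∀ b, 0 ≤ P2 b := fun _ => ENNReal.toReal_nonneg
  have hP1_sum : ∀ a, P1 a = ∑ b, P a b := fun a => PMF.toReal_map_fst p a
  have hP2_sum : ∀ b, P2 b = ∑ a, P a b := fun b => PMF.toReal_map_snd p b
  have hQ_nonneg : ∀ a, 0 ≤ Q a := fun a => Finset.sum_nonneg fun b _ => hP2_nonneg b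
  -- Gibbs inequality, termwise: `log y ≤ y - 1` compares the joint law with the one that draws `a`
  -- from `P1` and then `b` from `P2` conditioned on `G a`.
  have hterm : ∀ a b, P a b * -Real.log (Q a) ≤
      P a b * (Real.log (P a b) - Real.log (P1 a) - Real.log (P2 b)) +
        ((if b ∈ G a then P1 a * P2 b / Q a else 0) - P a b) := by
    intro a b
    rcases (hP_nonneg a b).eq_or_lt with h0 | h0
    · rw [← h0]
      have : 0 ≤ if b ∈ G a then P1 a * P2 b / Q a else 0 := by
        split_ifs
        · exact div_nonneg (mul_nonneg (hP1_nonneg a) (hP2_nonneg b)) (hQ_nonneg a)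
        · exact le_rfl
      linarith
    · have hb : b ∈ G a := hG a b ((p.mem_support_iff _).2 fun h => by simp [hP, h] at h0)
      have h1 : 0 < P1 a := h0.trans_le (by
        rw [hP1_sum]
        exact Finset.single_le_sum (fun b _ => hP_nonneg a b) (Finset.mem_univ b))
      have h2 : 0 < P2 b := h0.trans_le (by
        rw [hP2_sum]
        exact Finset.single_le_sum (fun a _ => hP_nonneg a b) (Finset.mem_univ a))
      have hq : 0 < Q a := h2.trans_le (Finset.single_le_sum (fun b _ => hP2_nonneg b) hb)
      have hl := Real.log_le_sub_one_of_pos (x := P1 a * P2 b / (P a b * Q a)) (by positivity)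
      rw [Real.log_div (by positivity) (by positivity), Real.log_mul h1.ne' h2.ne',
        Real.log_mul h0.ne' hq.ne'] at hl
      have hl' := mul_le_mul_of_nonneg_left hl h0.le
      have e : P a b * (P1 a * P2 b / (P a b * Q a) - 1) = P1 a * P2 b / Q a - P a b := by
        field_simp
      rw [e] at hl'
      rw [if_pos hb]
      linarith
  -- The comparison law may lose mass where `Q a = 0`, hence an inequality.
  have hrest : ∑ a, ∑ b, ((if b ∈ G a then P1 a * P2 b / Q a else 0) - P a b) ≤ 0 := by
    have : ∀ a, ∑ b, ((if b ∈ G a then P1 a * P2 b / Q a else 0) - P a b) ≤ 0 := by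
      intro a
      rw [Finset.sum_sub_distrib, ← hP1_sum, Finset.sum_ite_mem, Finset.univ_inter,
        ← Finset.sum_div, ← Finset.mul_sum, mul_div_assoc]
      have := mul_le_mul_of_nonneg_left (div_self_le_one (Q a)) (hP1_nonneg a)
      linarith
    exact Finset.sum_nonpos fun a _ => this a
  calc ∑ a, P1 a * -Real.log (Q a) = ∑ a, ∑ b, P a b * -Real.log (Q a) := by
        refine Finset.sum_congr rfl fun a _ => ?_
        rw [← Finset.sum_mul, ← hP1_sum]
    _ ≤ ∑ a, ∑ b, (P a b * (Real.log (P a b) - Real.log (P1 a) - Real.log (P2 b)) +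
        ((if b ∈ G a then P1 a * P2 b / Q a else 0) - P a b)) :=
        Finset.sum_le_sum fun a _ => Finset.sum_le_sum fun b _ => hterm a b
    _ ≤ mutualInfo p * Real.log 2 := by
        rw [mutualInfo_mul_log_two]
        simp only [Finset.sum_add_distrib]
        linarith

theorem jointLaw_map_fst {n k ℓ : ℕ} (D : PMF (Bits n))
    (κ : (Fin k → Bits n) → PMF (HelpString ℓ)) : (jointLaw D κ).map Prod.fst = iid D k := by
  rw [jointLaw, PMF.map_bind]
  simp only [PMF.map_comp]
  have : ∀ x, (κ x).map (Prod.fst ∘ Prod.mk x) = PMF.pure x := fun x => PMF.map_const _ x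
  simp only [this, PMF.bind_pure]

theorem mem_support_of_mem_support_jointLaw {n k ℓ : ℕ} {D : PMF (Bits n)}
    {κ : (Fin k → Bits n) → PMF (HelpString ℓ)} {x : Fin k → Bits n} {s : HelpString ℓ}
    (h : (x, s) ∈ (jointLaw D κ).support) : s ∈ (κ x).support := by
  rw [jointLaw, PMF.mem_support_bind_iff] at h
  obtain ⟨y, -, hy⟩ := h
  rw [PMF.mem_support_map_iff] at hy
  obtain ⟨t, ht, he⟩ := hy
  obtain ⟨rfl, rfl⟩ := Prod.mk.inj he
  exact ht

/-- If the help is a function of the instances, then its mutual information with them is its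
entropy. -/
theorem mutualInfo_jointLaw_pure {n k ℓ : ℕ} (D : PMF (Bits n))
    (s : (Fin k → Bits n) → HelpString ℓ) :
    mutualInfo (jointLaw D fun x => PMF.pure (s x)) = entropy ((iid D k).map s) := by
  have hj : jointLaw D (fun x => PMF.pure (s x)) = (iid D k).map fun x => (x, s x) := by
    simp only [jointLaw, PMF.pure_map]
    exact PMF.bind_pure_comp _ _
  rw [mutualInfo, jointLaw_map_fst, hj,
    entropy_map_of_injective _ fun x y h => (Prod.mk.inj h).1, PMF.map_comp]
  simp only [Function.comp_def]
  ring

/-! ### Averaging over independent instances -/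

theorem iid_toReal {α : Type} [Fintype α] (D : PMF α) (k : ℕ) (x : Fin k → α) :
    (iid D k x).toReal = ∏ i, (D (x i)).toReal := by
  rw [iid, PMF.ofFintype_apply, ENNReal.toReal_prod]

/-- Resampling one coordinate preserves a product law: swapping the old coordinate with the fresh
one is a weight-preserving involution. -/
theorem sum_prod_mul_sum_update {ι β : Type} [Fintype ι] [DecidableEq ι] [Fintype β] (p : β → ℝ)
    (f : (ι → β) → ℝ) (i : ι) (hp : ∑ a, p a = 1) :
    ∑ x : ι → β, (∏ j, p (x j)) * ∑ a, p a * f (Function.update x i a) =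
      ∑ x : ι → β, (∏ j, p (x j)) * f x := by
  have hinv : Function.Involutive
      fun z : (ι → β) × β => ((Function.update z.1 i z.2, z.1 i) : (ι → β) × β) := by
    rintro ⟨x, a⟩
    simp
  have hprod : ∀ (x : ι → β) (a : β),
      (∏ j, p (Function.update x i a j)) * p (x i) = (∏ j, p (x j)) * p a := by
    intro x a
    rw [← Finset.mul_prod_erase _ _ (Finset.mem_univ i),
      ← Finset.mul_prod_erase _ (fun j => p (x j)) (Finset.mem_univ i), Function.update_self,
      Finset.prod_congr rfl fun j hj => by rw [Function.update_of_ne (Finset.ne_of_mem_erase hj)]]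
    ring
  calc ∑ x : ι → β, (∏ j, p (x j)) * ∑ a, p a * f (Function.update x i a)
      = ∑ z : (ι → β) × β, (∏ j, p (Function.update z.1 i z.2 j)) * p (z.1 i) *
          f (Function.update z.1 i z.2) := by
        rw [Fintype.sum_prod_type]
        refine Finset.sum_congr rfl fun x _ => ?_
        rw [Finset.mul_sum]
        exact Finset.sum_congr rfl fun a _ => by rw [hprod]; ring
    _ = ∑ z : (ι → β) × β, (∏ j, p (z.1 j)) * p z.2 * f z.1 :=
        Equiv.sum_comp hinv.toPerm fun z : (ι → β) × β => (∏ j, p (z.1 j)) * p z.2 * f z.1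
    _ = ∑ x : ι → β, (∏ j, p (x j)) * f x := by
        rw [Fintype.sum_prod_type]
        refine Finset.sum_congr rfl fun x _ => ?_
        dsimp only
        rw [← Finset.sum_mul, ← Finset.mul_sum, hp, mul_one]

theorem exists_sum_mul_le {ι : Type} [Fintype ι] (p : ι → ℝ) (hp : ∀ x, 0 ≤ p x)
    (hsum : ∑ x, p x = 1) (g : ι → ℝ) : ∃ x, ∑ y, p y * g y ≤ g x := by
  have : Nonempty ι := by
    by_contra h
    rw [not_nonempty_iff] at h
    simp at hsum
  obtain ⟨x, hx⟩ := Finite.exists_max g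
  refine ⟨x, (Finset.sum_le_sum fun y _ => mul_le_mul_of_nonneg_left (hx y) (hp y)).trans_eq ?_⟩
  rw [← Finset.sum_mul, hsum, one_mul]

/-- All instances but the `i`-th can be fixed without decreasing an expected value. -/
theorem exists_sum_iid_le_sum_update {α : Type} [Fintype α] (D : PMF α) {k : ℕ}
    (f : (Fin k → α) → ℝ) (i : Fin k) :
    ∃ x, ∑ y, (iid D k y).toReal * f y ≤ ∑ a, (D a).toReal * f (Function.update x i a) := by
  obtain ⟨x, hx⟩ := exists_sum_mul_le (fun y => (iid D k y).toReal)
    (fun _ => ENNReal.toReal_nonneg) (PMF.sum_toReal _)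
    fun y => ∑ a, (D a).toReal * f (Function.update y i a)
  refine ⟨x, le_trans (le_of_eq ?_) hx⟩
  simp only [iid_toReal]
  exact (sum_prod_mul_sum_update _ f i (PMF.sum_toReal D)).symm

/-- Each ratio `r` satisfies `r ≥ (1 + log (2 * r)) / 2`, and the logarithms telescope. The tangent
is taken at `r = 1/2`, the success rate of blind guessing, so the bound is tight when every ratio is
`1/2`. -/
theorem log_le_sum_ratio (A : ℕ → ℝ) (k : ℕ) (hA : ∀ i ≤ k, 0 < A i) (hA0 : A 0 = 1) :
    (k : ℝ) / 2 * (1 + Real.log 2) + Real.log (A k) / 2 ≤ ∑ i : Fin k, A (i + 1) / A i := by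
  rw [Fin.sum_univ_eq_sum_range fun i => A (i + 1) / A i]
  have htel : Real.log (A k) = ∑ i ∈ Finset.range k, (Real.log (A (i + 1)) - Real.log (A i)) := by
    rw [Finset.sum_range_sub fun i => Real.log (A i), hA0, Real.log_one, sub_zero]
  have hterm : ∀ i ∈ Finset.range k,
      (1 + Real.log 2) / 2 + (Real.log (A (i + 1)) - Real.log (A i)) / 2 ≤ A (i + 1) / A i := by
    intro i hi
    have hi' := Finset.mem_range.1 hi
    have h0 := hA i hi'.le
    have h1 := hA (i + 1) hi'
    have h := Real.log_le_sub_one_of_pos (x := 2 * (A (i + 1) / A i)) (by positivity)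
    rw [Real.log_mul (by norm_num) (by positivity), Real.log_div h1.ne' h0.ne'] at h
    linarith
  have h := Finset.sum_le_sum hterm
  rw [Finset.sum_add_distrib, Finset.sum_const, Finset.card_range, nsmul_eq_mul,
    ← Finset.sum_div, ← htel] at h
  linarith

/-! ### Predicting one answer -/

/-- The weight of the help strings that lead to correct answers on the first `m` instances. -/
noncomputable def prefixWeight (L : Language Bool) {n k ℓ : ℕ} (C : SolverCircuit n k ℓ)
    (w : HelpString ℓ → ℝ) (x : Fin k → Bits n) (m : ℕ) : ℝ :=
  ∑ s with ∀ j : Fin k, (j : ℕ) < m → C.run x s j = answer L (x j), w s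

/-- With help of small mutual information, some bit is predicted well, given the answers to the
preceding instances, by a sample from the marginal law of the help. -/
theorem exists_prefixWeight_ratio {L : Language Bool} {n k ℓ : ℕ} {D : PMF (Bits n)}
    {C : SolverCircuit n k ℓ} {κ : (Fin k → Bits n) → PMF (HelpString ℓ)} {δ : ℝ} (hk : 1 ≤ k)
    (hδ : 0 ≤ δ)
    (hC : ∀ x, ∀ s ∈ (κ x).support, C.run x s = fun i => answer L (x i))
    (hI : mutualInfo (jointLaw D κ) ≤ k - 3 * k * δ) :
    ∃ i : Fin k, 1 / 2 + δ ≤ ∑ x, (iid D k x).toReal *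
      (prefixWeight L C (fun s => ((jointLaw D κ).map Prod.snd s).toReal) x (i + 1) /
        prefixWeight L C (fun s => ((jointLaw D κ).map Prod.snd s).toReal) x i) := by
  set w : HelpString ℓ → ℝ := fun s => ((jointLaw D κ).map Prod.snd s).toReal with hw
  set p : (Fin k → Bits n) → ℝ := fun x => (iid D k x).toReal with hp
  set A := prefixWeight L C w with hA
  have hw0 : ∀ s, 0 ≤ w s := fun s => ENNReal.toReal_nonneg
  have hp0 : ∀ x, 0 ≤ p x := fun s => ENNReal.toReal_nonneg
  have hp1 : ∑ x, p x = 1 := PMF.sum_toReal _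
  have hA0 : ∀ x, A x 0 = 1 := by
    intro x
    simp only [hA, prefixWeight, Nat.not_lt_zero, false_imp_iff, implies_true, Finset.filter_true]
    exact PMF.sum_toReal _
  have hAk : ∀ x, A x k = ∑ s with C.run x s = fun i => answer L (x i), w s := by
    intro x
    simp only [hA, prefixWeight, Fin.is_lt, true_imp_iff, funext_iff]
  have hanti : ∀ x, ∀ i ≤ k, A x k ≤ A x i := by
    intro x i hi
    refine Finset.sum_le_sum_of_subset_of_nonneg ?_ fun s _ _ => hw0 s
    intro s hs
    simp only [Finset.mem_filter, Finset.mem_univ, true_and] at hs ⊢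
    exact fun j hj => hs j (by omega)
  -- An `x` of positive probability receives some valid help string, which has positive marginal
  -- weight; thus the logarithms below are genuine.
  have hpos : ∀ x, p x ≠ 0 → 0 < A x k := by
    intro x hx
    have hmarg : p x = ∑ s, (jointLaw D κ (x, s)).toReal := by
      rw [hp, ← PMF.toReal_map_fst, jointLaw_map_fst]
    rw [hmarg] at hx
    obtain ⟨s, -, hs⟩ := Finset.exists_ne_zero_of_sum_ne_zero hx
    have hws : 0 < w s := by
      rw [hw]
      simp only [PMF.toReal_map_snd]
      exact (lt_of_le_of_ne ENNReal.toReal_nonneg hs.symm).trans_le (Finset.single_le_sum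
        (f := fun x => (jointLaw D κ (x, s)).toReal) (fun _ _ => ENNReal.toReal_nonneg)
        (Finset.mem_univ x))
    have hmem : s ∈ (κ x).support := mem_support_of_mem_support_jointLaw (D := D)
      ((PMF.mem_support_iff _ _).2 fun h => hs (by rw [h, ENNReal.toReal_zero]))
    rw [hAk]
    exact hws.trans_le (Finset.single_le_sum (fun s _ => hw0 s)
      (Finset.mem_filter.2 ⟨Finset.mem_univ s, hC x s hmem⟩))
  have hlog : ∑ x, p x * -Real.log (A x k) ≤ (k - 3 * k * δ) * Real.log 2 := by
    have h := sum_neg_log_le_mutualInfo (jointLaw D κ)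
      (fun x => Finset.univ.filter fun s => C.run x s = fun i => answer L (x i)) (by
        intro x s hs
        exact Finset.mem_filter.2
          ⟨Finset.mem_univ s, hC x s (mem_support_of_mem_support_jointLaw hs)⟩)
    rw [jointLaw_map_fst] at h
    simp only [hAk]
    exact h.trans (mul_le_mul_of_nonneg_right hI (Real.log_nonneg (by norm_num)))
  have hratio : ∀ x, p x * ((k : ℝ) / 2 * (1 + Real.log 2)) - p x * -Real.log (A x k) / 2 ≤
      p x * ∑ i : Fin k, A x (i + 1) / A x i := by
    intro x
    rcases eq_or_ne (p x) 0 with h0 | h0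
    · simp [h0]
    · have h := mul_le_mul_of_nonneg_left (log_le_sum_ratio (A x) k
        (fun i hi => (hpos x h0).trans_le (hanti x i hi)) (hA0 x)) (hp0 x)
      linarith
  have hsum := Finset.sum_le_sum fun x (_ : x ∈ Finset.univ) => hratio x
  rw [Finset.sum_sub_distrib, ← Finset.sum_mul, hp1, ← Finset.sum_div] at hsum
  simp only [Finset.mul_sum] at hsum
  rw [Finset.sum_comm] at hsum
  have hkδ : 0 ≤ (k : ℝ) * δ := mul_nonneg (Nat.cast_nonneg k) hδ
  -- The information bound leaves `k / 2 + (3 / 2) * log 2 * k * δ`, and `(3 / 2) * log 2 > 1`; this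
  -- is the role of the constant `3`.
  have htotal : ∑ _i : Fin k, (1 / 2 + δ) ≤
      ∑ i : Fin k, ∑ x, p x * (A x (i + 1) / A x i) := by
    rw [Finset.sum_const, Finset.card_univ, Fintype.card_fin, nsmul_eq_mul]
    have h2 := Real.log_two_gt_d9
    nlinarith
  have hne : (Finset.univ : Finset (Fin k)).Nonempty := ⟨⟨0, hk⟩, Finset.mem_univ _⟩
  obtain ⟨i, -, hi⟩ := Finset.exists_le_of_sum_le hne htotal
  exact ⟨i, hi⟩

/-! ### The predictor as a circuit -/

theorem HasBoolCircuit.elim_proj {W : Type} {f : (W → Bool) → Bool} {m : ℕ}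
    (hf : HasBoolCircuit f m) (w : W) :
    HasCircuit (fun v => Sum.elim (fun _ : Unit => f v) (fun _ : Unit => v w)) m := by
  have h : HasCircuit (W := W ⊕ Unit) (O := Unit ⊕ Unit)
      (fun v o => v (Sum.elim Sum.inr (fun _ => Sum.inl w) o)) 0 :=
    ⟨.out fun o => Sum.elim Sum.inr (fun _ => Sum.inl w) o, le_rfl, fun _ => rfl⟩
  convert HasCircuit.append hf h using 2 with v
  · funext o
    rcases o with _ | _ <;> rfl
  · rw [add_zero]

/-- A solver remains a small circuit when the help and all instances but one are fixed. -/
theorem hasCircuit_run_update {n k ℓ : ℕ} (C : SolverCircuit n k ℓ) (x : Fin k → Bits n)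
    (i : Fin k) (s : HelpString ℓ) :
    HasCircuit (fun v : Bits n => C.run (Function.update x i v) s) (2 + C.size) := by
  have h := (hasCircuit_substitution (W' := Fin n)
    (Sum.elim (fun q : Fin k × Fin n => if q.1 = i then Sum.inr q.2 else Sum.inl (x q.1 q.2))
      (fun t => Sum.inl (s.encode t)))).comp ⟨C, le_rfl, fun _ => rfl⟩
  convert h using 2 with v
  rw [SolverCircuit.run]
  congr 1
  funext q
  rcases q with ⟨j, b⟩ | t
  · by_cases hj : j = i
    · subst hj
      simp
    · simp [hj]
  · rfl

theorem toReal_toOuterMeasure_eq_sum {α : Type} [Fintype α] (p : PMF α) (f g : α → Bool) :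
    (p.toOuterMeasure {x | f x = g x}).toReal =
      ∑ x, (p x).toReal * if f x = g x then 1 else 0 := by
  rw [PMF.toOuterMeasure_apply_fintype, ENNReal.toReal_sum]
  · refine Finset.sum_congr rfl fun x _ => ?_
    by_cases h : f x = g x <;> simp [Set.indicator, h]
  · intro x _
    by_cases h : f x = g x <;> simp [Set.indicator, h, p.apply_ne_top]

/-- The circuit places its input at position `i` among fixed instances, tries the help strings in a
fixed order, and outputs bit `i` of the first run that is correct on the instances before `i`. -/
theorem exists_circuit_of_mutualInfo_le {L : Language Bool} {n k ℓ : ℕ} {D : PMF (Bits n)}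
    {C : SolverCircuit n k ℓ} {κ : (Fin k → Bits n) → PMF (HelpString ℓ)} {δ : ℝ} (hk : 1 ≤ k)
    (hδ : 0 ≤ δ)
    (hC : ∀ x, ∀ s ∈ (κ x).support, C.run x s = fun i => answer L (x i))
    (hI : mutualInfo (jointLaw D κ) ≤ k - 3 * k * δ) :
    ∃ B : Circuit Unit (Fin n),
      B.size ≤ Fintype.card (HelpString ℓ) * (C.size + (k * 2 + 7)) + 1 ∧
      1 / 2 + δ ≤ (D.toOuterMeasure {x | B.eval x () = answer L x}).toReal := by
  classical
  obtain ⟨i, hi⟩ := exists_prefixWeight_ratio hk hδ hC hI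
  set w : HelpString ℓ → ℝ := fun s => ((jointLaw D κ).map Prod.snd s).toReal with hw
  obtain ⟨x, hx⟩ := exists_sum_iid_le_sum_update D
    (fun y => prefixWeight L C w y (i + 1) / prefixWeight L C w y i) i
  set J : List (Fin k) := (List.finRange k).filter fun j => j < i with hJ
  set check : (Fin k → Bool) → Bool := fun o => J.all fun j => o j == answer L (x j) with hcheck
  -- The ordering lemma needs positive weights; discarding null strings changes no weighted sum.
  set T : Finset (HelpString ℓ) := Finset.univ.filter fun s => w s ≠ 0 with hT
  obtain ⟨l, hl, hle⟩ := exists_list_firstMatch w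
    (fun (a : Bits n) s => check (C.run (Function.update x i a) s))
    (fun a s => C.run (Function.update x i a) s i == answer L a) T
    (fun s hs => lt_of_le_of_ne ENNReal.toReal_nonneg (Finset.mem_filter.1 hs).2.symm)
    (fun a => (D a).toReal) (fun _ => ENNReal.toReal_nonneg)
  have hsumT : ∀ (P : HelpString ℓ → Prop) [DecidablePred P],
      ∑ s ∈ T with P s, w s = ∑ s with P s, w s := by
    intro P _
    rw [Finset.sum_filter P, Finset.sum_filter P]
    refine Finset.sum_subset (f := fun s => if P s then w s else 0) (Finset.subset_univ T)
      fun s _ hs => ?_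
    have : w s = 0 := by simpa [hT] using hs
    simp [this]
  have hcheck_iff : ∀ a s, check (C.run (Function.update x i a) s) = true ↔
      ∀ j : Fin k, (j : ℕ) < i → C.run (Function.update x i a) s j =
        answer L (Function.update x i a j) := by
    intro a s
    simp only [hcheck, hJ, List.all_eq_true, List.mem_filter, List.mem_finRange, true_and,
      decide_eq_true_eq, beq_iff_eq]
    refine forall_congr' fun j => ?_
    rw [Fin.lt_def]
    refine imp_congr_right fun hj => ?_
    rw [Function.update_of_ne (by rintro rfl; exact lt_irrefl _ hj)]
  have hden : ∀ a, ∑ s ∈ T with check (C.run (Function.update x i a) s) = true, w s =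
      prefixWeight L C w (Function.update x i a) i := by
    intro a
    rw [hsumT, prefixWeight]
    simp only [hcheck_iff]
  have hnum : ∀ a, ∑ s ∈ T with (check (C.run (Function.update x i a) s) &&
      (C.run (Function.update x i a) s i == answer L a)) = true, w s =
      prefixWeight L C w (Function.update x i a) (i + 1) := by
    intro a
    rw [hsumT, prefixWeight]
    refine Finset.sum_congr (Finset.filter_congr fun s _ => ?_) fun _ _ => rfl
    rw [Bool.and_eq_true, hcheck_iff, beq_iff_eq]
    constructor
    · rintro ⟨h1, h2⟩ j hj
      rcases Nat.lt_succ_iff_lt_or_eq.1 hj with hj | hj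
      · exact h1 j hj
      · rw [Fin.ext hj, Function.update_self]
        exact h2
    · intro h
      refine ⟨fun j hj => h j (by omega), ?_⟩
      have := h i (Nat.lt_succ_self _)
      rwa [Function.update_self] at this
  simp only [hden, hnum] at hle
  have hJlen : J.length ≤ k := (List.length_filter_le _ _).trans_eq (List.length_finRange)
  have hcirc : ∀ s, HasCircuit (fun v : Bits n =>
      Sum.elim (fun _ : Unit => check (C.run (Function.update x i v) s))
        (fun _ : Unit => C.run (Function.update x i v) s i)) (C.size + (k * 2 + 3)) := by
    intro s
    -- Besides the solver: two gates for the constants, two per checked answer, and one for the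
    -- empty conjunction.
    have h := (hasCircuit_run_update C x i s).comp (HasBoolCircuit.elim_proj
      (hasBoolCircuit_all (fun j => hasBoolCircuit_eq_const j (answer L (x j))) J) i)
    refine h.mono ?_
    omega
  obtain ⟨B, hB, hBe⟩ := hasBoolCircuit_firstMatch hcirc l
  refine ⟨B, hB.trans ?_, ?_⟩
  · have := hl.trans (Finset.card_le_univ T)
    exact Nat.add_le_add_right (Nat.mul_le_mul this (by omega)) 1
  · refine (hi.trans (hx.trans hle)).trans ?_
    rw [toReal_toOuterMeasure_eq_sum D (fun x => B.eval x ()) (answer L)]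
    refine Finset.sum_le_sum fun a _ => mul_le_mul_of_nonneg_left ?_ ENNReal.toReal_nonneg
    rw [hBe]
    split_ifs with h1 h2
    · exact le_rfl
    · exact absurd (firstMatch_eq_of_firstMatch_beq h1) h2
    · exact zero_le_one
    · exact le_rfl

/-! ### From one input length to all -/

theorem exists_circuit_answer (L : Language Bool) {n : ℕ} (D : PMF (Bits n)) :
    ∃ B : Circuit Unit (Fin n),
      (D.toOuterMeasure {x | B.eval x () = answer L x}).toReal = 1 := by
  obtain ⟨m, B, -, hB⟩ := exists_hasBoolCircuit (answer L (n := n))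
  refine ⟨B, ?_⟩
  rw [toReal_toOuterMeasure_eq_sum D (fun x => B.eval x ()) (answer L)]
  simp only [hB, if_true, mul_one]
  exact PMF.sum_toReal D

/-- The circuits are chosen separately for each `n`. At the finitely many lengths with `δ n < 0` an
exact circuit of uncontrolled size is used, which does not affect a polynomial bound. -/
theorem solvableOnAverage_of_mutualInfo_le {L : Language Bool} {D : ∀ n : ℕ, PMF (Bits n)}
    {k ℓ : ℕ → ℕ} {δ : ℕ → ℝ} (hk_pos : ∀ n, 1 ≤ k n) (hk : PolyBounded k)
    (hℓ : PolyBounded fun n => Fintype.card (HelpString (ℓ n)))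
    (hδ_nonneg : ∀ᶠ n in Filter.atTop, 0 ≤ δ n)
    {C : ∀ n, SolverCircuit n (k n) (ℓ n)} (hC : PolyBounded fun n => (C n).size)
    {κ : ∀ n, (Fin (k n) → Bits n) → PMF (HelpString (ℓ n))}
    (hκ : ∀ n (x : Fin (k n) → Bits n), ∀ s ∈ (κ n x).support,
      (C n).run x s = fun i => answer L (x i))
    (hI : ∀ n, mutualInfo (jointLaw (D n) (κ n)) ≤ k n - 3 * k n * δ n) :
    SolvableOnAverage L D fun n => 1 / 2 + δ n := by
  have h : ∀ n, ∃ B : Circuit Unit (Fin n),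
      (0 ≤ δ n → B.size ≤ Fintype.card (HelpString (ℓ n)) * ((C n).size + (k n * 2 + 7)) + 1) ∧
      1 / 2 + δ n ≤ ((D n).toOuterMeasure {x | B.eval x () = answer L x}).toReal := by
    intro n
    by_cases hn : 0 ≤ δ n
    · obtain ⟨B, hB, hB'⟩ := exists_circuit_of_mutualInfo_le (hk_pos n) hn (hκ n) (hI n)
      exact ⟨B, fun _ => hB, hB'⟩
    · obtain ⟨B, hB⟩ := exists_circuit_answer L (D n)
      refine ⟨B, fun h => absurd h hn, ?_⟩
      rw [hB]
      linarith
  choose B hB hB' using h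
  exact ⟨B, ((hℓ.mul (hC.add ((hk.mul (PolyBounded.const 2)).add (PolyBounded.const 7)))).add
    (PolyBounded.const 1)).of_eventually_le (hδ_nonneg.mono hB), hB'⟩

end HelpBits

theorem theorem3
    (L : Language Bool) (D : ∀ n : ℕ, PMF (HelpBits.Bits n))
    (k ℓ : ℕ → ℕ) (δ : ℕ → ℝ)
    (hk_pos : ∀ n, 1 ≤ k n)
    (hk : (fun n => (k n : ℝ)) =O[Filter.atTop] fun n => Real.logb 2 (n : ℝ))
    (hℓ : HelpBits.PolyBounded fun n => Fintype.card (HelpBits.HelpString (ℓ n)))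
    (hδ_lower : ∃ c : ℕ, ∀ᶠ n : ℕ in Filter.atTop, 1 / (n : ℝ) ^ c < δ n)
    (hδ_upper : ∀ n, δ n < 1 / 2)
    (C : ∀ n, HelpBits.SolverCircuit n (k n) (ℓ n))
    (hC : HelpBits.PolyBounded fun n => (C n).size) :
    -- help that is a function of the instances, measured by its entropy
    (∀ s : ∀ n, (Fin (k n) → HelpBits.Bits n) → HelpBits.HelpString (ℓ n),
      (∀ n (x : Fin (k n) → HelpBits.Bits n),
        (C n).run x (s n x) = fun i => HelpBits.answer L (x i)) →
      (∀ n, HelpBits.entropy ((HelpBits.iid (D n) (k n)).map (s n)) ≤ k n - 3 * k n * δ n) →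
      HelpBits.SolvableOnAverage L D fun n => 1 / 2 + δ n) ∧
    -- help that may also be random given the instances, measured by its mutual information
    (∀ κ : ∀ n, (Fin (k n) → HelpBits.Bits n) → PMF (HelpBits.HelpString (ℓ n)),
      (∀ n (x : Fin (k n) → HelpBits.Bits n), ∀ s ∈ (κ n x).support,
        (C n).run x s = fun i => HelpBits.answer L (x i)) →
      (∀ n, HelpBits.mutualInfo (HelpBits.jointLaw (D n) (κ n)) ≤ k n - 3 * k n * δ n) →
      HelpBits.SolvableOnAverage L D fun n => 1 / 2 + δ n) := by
  have hk' := HelpBits.polyBounded_of_isBigO_logb hk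
  have hδ_nonneg : ∀ᶠ n in Filter.atTop, 0 ≤ δ n := by
    obtain ⟨c, hc⟩ := hδ_lower
    filter_upwards [hc] with n hn
    exact (lt_of_le_of_lt (by positivity) hn).le
  refine ⟨fun s hs hH => ?_, fun κ hκ hI =>
    HelpBits.solvableOnAverage_of_mutualInfo_le hk_pos hk' hℓ hδ_nonneg hC hκ hI⟩
  refine HelpBits.solvableOnAverage_of_mutualInfo_le hk_pos hk' hℓ hδ_nonneg hC
    (κ := fun n x => PMF.pure (s n x)) (fun n x t ht => ?_) fun n => ?_
  · rw [PMF.mem_support_pure_iff] at ht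
    rw [ht]
    exact hs n x
  · rw [HelpBits.mutualInfo_jointLaw_pure]
    exact hH n
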